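/- Let $S$ be a set of $n\ge 4$ points in the plane in general position, meaning that no three points of $S$ are collinear and no four are cocircular. Let $\overline{cr}(S)$ be the rectilinear crossing number of $S$, i.e. the number of pairs of edges that cross in the straight-line drawing of the complete graph with vertex set $S$. For $k\ge 0$ let $c_k$ be the number of circles through three points of $S$ that have exactly $k$ points of $S$ strictly in their interior. For $1\le k\le n-1$ let $v_k$ be the number of vertices of the order-$k$ Voronoi diagram of $S$ (the subdivision of the plane into cells of points having the same $k$ nearest points of $S$; its vertices are the points in which at least three closed cells meet). For $j\ge 0$ let $e_j$ be the number of directed lines through two points of $S$ whose open right half-plane contains exactly $j$ points of $S$, and let $E_{\le k}=\sum_{j=0}^{k} e_j$. Then the following hold. 1) $$\overline{cr}(S)=\sum_{j=0}^{n-3} c_j\left(\frac{4}{3(n-3)}\sum_{k=1}^{n-3}\frac{z_k^{j+1}}{(z_k-1)^2}\right),$$ where $z_1,\dots,z_{n-3}$ are the complex $(n-3)$-th roots of $-3$. 2) $$\overline{cr}(S)=\sum_{j=1}^{n-1} v_j\left(\frac{2}{3(n-1)}\sum_{k=1}^{n-1}\frac{z_k^{j}}{(z_k-1)^2}\right),$$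 where $z_1,\dots,z_{n-1}$ are the complex $(n-1)$-th roots of $-3$. 3) $$\overline{cr}(S)=\sum_{j=0}^{n-3} E_{\le j}\left(\frac{-4}{n-3}\sum_{k=1}^{n-3}\frac{z_k^{j+1}}{(z_k-1)^2}\right),$$ where $z_1,\dots,z_{n-3}$ are the complex $(n-3)$-th roots of $-\tfrac13$. -/

import Mathlib

/-! Finite point sets in the plane. The plane is identified with `ℂ`, which carries the Euclidean
distance. -/

namespace PointSet

/-- `S` is in general position: no three points of `S` are collinear and no four are cocircular. -/
def GeneralPosition (S : Finset ℂ) : Prop :=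
  (∀ T ⊆ S, T.card = 3 → ¬ Collinear ℝ (T : Set ℂ)) ∧
  (∀ T ⊆ S, T.card = 4 → ¬ EuclideanGeometry.Cospherical (T : Set ℂ))

/-- The rectilinear crossing number of `S`: the number of unordered pairs of distinct edges of the
straight-line drawing of the complete graph on `S` that cross (edges are two-element subsets of `S`,
and two edges cross when the corresponding open segments have a common point). -/
noncomputable def crossingNumber (S : Finset ℂ) : ℕ :=
  {P : Finset (Finset ℂ) | P ∈ (S.powersetCard 2).powersetCard 2 ∧
    ∃ a b c d : ℂ, P = {{a, b}, {c, d}} ∧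
      (openSegment ℝ a b ∩ openSegment ℝ c d).Nonempty}.ncard

/-- `c_k`: the number of circles that pass through (at least) three points of `S` and enclose
exactly `k` points of `S`, i.e. have exactly `k` points of `S` strictly inside. -/
noncomputable def numCircles (S : Finset ℂ) (k : ℕ) : ℕ :=
  {C : EuclideanGeometry.Sphere ℂ |
    (∃ T ⊆ S, T.card = 3 ∧ ∀ p ∈ T, p ∈ C) ∧
    {s : ℂ | s ∈ S ∧ dist s C.center < C.radius}.ncard = k}.ncard

/-- The (closed) cell of the subset `A` of `S` in the Voronoi diagram of order `A.card` of `S`: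
the points of the plane for which `A` is a set of `A.card` nearest points of `S`. -/
def voronoiCell (S A : Finset ℂ) : Set ℂ :=
  {x | ∀ a ∈ A, ∀ b ∈ S, b ∉ A → dist x a ≤ dist x b}

/-- The vertices of the order-`k` Voronoi diagram of `S`: the points of the plane in which at least
three of its cells meet. -/
def voronoiVertices (S : Finset ℂ) (k : ℕ) : Set ℂ :=
  {x | 3 ≤ {A : Finset ℂ | A ⊆ S ∧ A.card = k ∧ x ∈ voronoiCell S A}.ncard}

/-- `v_k`: the number of vertices of the order-`k` Voronoi diagram of `S`. -/
noncomputable def numVoronoiVertices (S : Finset ℂ) (k : ℕ) : ℕ :=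
  (voronoiVertices S k).ncard

/-- The point `r` lies in the open half-plane to the right of the line through `p` and `q`,
directed from `p` to `q`. -/
def RightOf (p q r : ℂ) : Prop :=
  (q.re - p.re) * (r.im - p.im) - (q.im - p.im) * (r.re - p.re) < 0

/-- `e_j`: the number of (oriented) `j`-edges of `S`, i.e. of ordered pairs of distinct points of
`S` whose directed line has exactly `j` points of `S` in the open half-plane to its right. (When no
three points of `S` are collinear, such pairs correspond to the directed lines through two points
of `S`.) -/
noncomputable def numEdges (S : Finset ℂ) (j : ℕ) : ℕ :=
  {e : ℂ × ℂ | e.1 ∈ S ∧ e.2 ∈ S ∧ e.1 ≠ e.2 ∧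
    {r : ℂ | r ∈ S ∧ RightOf e.1 e.2 r}.ncard = j}.ncard

/-- `E_{≤ k} = e_0 + ⋯ + e_k`: the number of `(≤ k)`-edges of `S`. -/
noncomputable def numEdgesLE (S : Finset ℂ) (k : ℕ) : ℕ :=
  ∑ j ∈ Finset.Icc 0 k, numEdges S j

end PointSet

/-! The roots of unity are a disguise: over the `m`-th roots `z` of `a`, the sum of `z ^ (j + 1) /
(z - 1) ^ 2` is an affine function of `j` for `j ≤ m` (`sum_nthRootsFinset_pow_div`). The weights
become `j - (n-3)/4` for `c_j`, `(4(j-1) - (n-1))/8` for `v_j` and `3(n-3)/4 - j` for `E_{≤j}`.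

The resulting linear formulas come from double counting over four-point subsets. Four points in
convex position have one crossing among their three pairings, two of four circumcircles containing
the remaining point, and four of six lines with the other two points on one side; in non-convex
position these numbers are 0, 1 and 3. Each is thus a constant plus a multiple of the convexity
indicator. Summed over ordered quadruples, this expresses the crossing number through the points
inside circles (`four_mul_quadSum_insideInd`) or on one side of lines (`six_mul_quadSum_sideInd`).

Every circle contributes its number of interior points, which gives the first formula. A pair with
`r` and `l` points on its two sides contributes `r(r-1) + l(l-1)`, which summation over `j` recovers
from the `E_{≤j}`. A circle with `k` points inside has as center a Voronoi vertex of orders `k+1`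
and `k+2` exactly, so the second formula follows from the first. -/

/-! ### Sums over the `m`-th roots of a complex number. -/

theorem sum_range_succ_mul_pow (m : ℕ) (z : ℂ) :
    (1 - z) ^ 2 * ∑ r ∈ Finset.range m, ((r : ℂ) + 1) * z ^ r =
      1 - (m + 1) * z ^ m + m * z ^ (m + 1) := by
  induction m with
  | zero => simp
  | succ k ih =>
    rw [Finset.sum_range_succ, mul_add, ih]
    push_cast
    ring

theorem sum_nthRootsFinset_eq {m : ℕ} (hm : m ≠ 0) {a : ℂ} (ha : a ≠ 0) :
    ∃ ζ α : ℂ, IsPrimitiveRoot ζ m ∧ α ^ m = a ∧ ∀ f : ℂ → ℂ,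
      ∑ z ∈ Polynomial.nthRootsFinset m a, f z = ∑ i ∈ Finset.range m, f (ζ ^ i * α) := by
  classical
  obtain ⟨α, hα⟩ := IsAlgClosed.exists_pow_nat_eq a (Nat.pos_of_ne_zero hm)
  have hζ := Complex.isPrimitiveRoot_exp m hm
  refine ⟨_, α, hζ, hα, fun f => ?_⟩
  have hn := hζ.nthRoots_nodup (a := a) ha
  rw [Finset.sum, Polynomial.nthRootsFinset_def, Multiset.toFinset_val, hn.dedup,
    hζ.nthRoots_eq hα, Multiset.map_map]
  rfl

theorem sum_nthRootsFinset_pow {m : ℕ} (hm : m ≠ 0) {a : ℂ} (ha : a ≠ 0) {k : ℕ}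
    (hk : ¬ m ∣ k) : ∑ z ∈ Polynomial.nthRootsFinset m a, z ^ k = 0 := by
  obtain ⟨ζ, α, hζ, -, h⟩ := sum_nthRootsFinset_eq hm ha
  rw [h]
  have h1 : ζ ^ k ≠ 1 := fun h => hk ((hζ.pow_eq_one_iff_dvd k).1 h)
  have h2 : ∑ i ∈ Finset.range m, (ζ ^ k) ^ i = 0 := by
    rw [geom_sum_eq h1, ← pow_mul, mul_comm, pow_mul, hζ.pow_eq_one]
    simp
  calc ∑ i ∈ Finset.range m, (ζ ^ i * α) ^ k = (∑ i ∈ Finset.range m, (ζ ^ k) ^ i) * α ^ k := by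
        rw [Finset.sum_mul]
        refine Finset.sum_congr rfl fun i _ => ?_
        rw [mul_pow, ← pow_mul, ← pow_mul, mul_comm i k]
    _ = 0 := by rw [h2, zero_mul]

theorem card_nthRootsFinset_of_ne_zero {m : ℕ} (hm : m ≠ 0) {a : ℂ} (ha : a ≠ 0) :
    ((Polynomial.nthRootsFinset m a).card : ℂ) = m := by
  obtain ⟨ζ, α, -, -, h⟩ := sum_nthRootsFinset_eq hm ha
  simpa using h fun _ => 1

/-- When `z ^ m = a`, the differentiated geometric sum times `(1 - z) ^ 2` equals `(1 - a) + m a (z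
- 1)`; a multiple of the plain geometric sum removes the second term. This turns the summands into
polynomials in `z`, to which orthogonality of powers applies. -/
theorem inv_sub_one_sq_of_pow_eq {m : ℕ} {a z : ℂ} (hz : z ^ m = a) (h1 : a ≠ 1) :
    1 / (z - 1) ^ 2 =
      ∑ r ∈ Finset.range m, ((r + 1) / (1 - a) + m * a / (1 - a) ^ 2) * z ^ r := by
  have hz1 : z - 1 ≠ 0 := by
    intro h
    apply h1
    rw [← hz, sub_eq_zero.1 h, one_pow]
  have ha : 1 - a ≠ 0 := sub_ne_zero.2 (Ne.symm h1)
  have h2 := sum_range_succ_mul_pow m z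
  have h3 := geom_sum_mul z m
  rw [pow_succ z m, hz] at h2
  rw [hz] at h3
  have h4 : ∑ r ∈ Finset.range m, (((r : ℂ) + 1) / (1 - a) + m * a / (1 - a) ^ 2) * z ^ r =
      (∑ r ∈ Finset.range m, ((r : ℂ) + 1) * z ^ r) / (1 - a) +
        m * a / (1 - a) ^ 2 * ∑ r ∈ Finset.range m, z ^ r := by
    rw [Finset.sum_div, Finset.mul_sum, ← Finset.sum_add_distrib]
    refine Finset.sum_congr rfl fun r _ => by ring
  rw [h4]
  field_simp
  linear_combination (-(1 - a)) * h2 - (m * a * (z - 1)) * h3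

theorem sum_nthRootsFinset_pow_div {m : ℕ} (hm : m ≠ 0) {a : ℂ} (ha : a ≠ 0) (h1 : a ≠ 1)
    {j : ℕ} (hj : j ≤ m) :
    ∑ z ∈ Polynomial.nthRootsFinset m a, z ^ (j + 1) / (z - 1) ^ 2 =
      m * a * ((m - j) / (1 - a) + m * a / (1 - a) ^ 2) := by
  have key : ∑ z ∈ Polynomial.nthRootsFinset m a, z ^ (j + 1) / (z - 1) ^ 2 =
      ∑ r ∈ Finset.range m, (((r : ℂ) + 1) / (1 - a) + m * a / (1 - a) ^ 2) *
        ∑ z ∈ Polynomial.nthRootsFinset m a, z ^ (j + 1 + r) := by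
    simp_rw [Finset.mul_sum]
    rw [Finset.sum_comm]
    refine Finset.sum_congr rfl fun z hz => ?_
    rw [Polynomial.mem_nthRootsFinset (Nat.pos_of_ne_zero hm)] at hz
    rw [div_eq_mul_one_div, inv_sub_one_sq_of_pow_eq hz h1, Finset.mul_sum]
    refine Finset.sum_congr rfl fun r _ => by ring
  have hpow : ∀ q : ℕ, ∑ z ∈ Polynomial.nthRootsFinset m a, z ^ (m * q) = m * a ^ q := by
    intro q
    rw [← card_nthRootsFinset_of_ne_zero hm ha, ← nsmul_eq_mul, ← Finset.sum_const]
    refine Finset.sum_congr rfl fun z hz => ?_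
    rw [Polynomial.mem_nthRootsFinset (Nat.pos_of_ne_zero hm)] at hz
    rw [pow_mul, hz]
  have ha' : 1 - a ≠ 0 := sub_ne_zero.2 (Ne.symm h1)
  rw [key]
  -- The exponents `j + 1, ..., j + m` contain one multiple of `m`, the only one that survives: it
  -- is `m` if `j < m` and `2m` if `j = m`. Both give the same closed formula.
  rcases hj.lt_or_eq with hj | rfl
  · rw [Finset.sum_eq_single (m - 1 - j)]
    · have e : j + 1 + (m - 1 - j) = m * 1 := by omega
      have e' : ((m - 1 - j : ℕ) : ℂ) + 1 = m - j := by
        rw [← Nat.cast_sub hj.le, ← Nat.cast_succ]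
        congr 1
        omega
      rw [e, hpow, e']
      ring
    · intro r hr hne
      rw [sum_nthRootsFinset_pow hm ha, mul_zero]
      rintro ⟨q, hq⟩
      have := Finset.mem_range.1 hr
      rcases Nat.lt_or_ge q 2 with h | h
      · interval_cases q <;> omega
      · have := Nat.mul_le_mul_left m h
        omega
    · intro h
      exact absurd (Finset.mem_range.2 (by omega)) h
  · rw [Finset.sum_eq_single (j - 1)]
    · have e : j + 1 + (j - 1) = j * 2 := by omega
      have e' : ((j - 1 : ℕ) : ℂ) + 1 = j := by
        rw [← Nat.cast_succ]
        congr 1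
        omega
      rw [e, hpow, e']
      field_simp
      ring
    · intro r hr hne
      rw [sum_nthRootsFinset_pow hm ha, mul_zero]
      rintro ⟨q, hq⟩
      have := Finset.mem_range.1 hr
      rcases Nat.lt_or_ge q 2 with h | h
      · interval_cases q <;> omega
      · rcases h.lt_or_eq with h | rfl
        · have := Nat.mul_le_mul_left j h
          simp only [Nat.succ_eq_add_one] at this
          omega
        · omega
    · intro h
      exact absurd (Finset.mem_range.2 (by omega)) h

/-! ### Signed areas and crossing segments. -/

namespace PointSet

/-- Twice the signed area of the triangle with vertices `p`, `q`, `r`. -/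
def area (p q r : ℂ) : ℝ :=
  (q.re - p.re) * (r.im - p.im) - (q.im - p.im) * (r.re - p.re)

theorem area_swap (p q r : ℂ) : area p r q = -area p q r := by
  unfold area; ring

theorem area_swap' (p q r : ℂ) : area q p r = -area p q r := by
  unfold area; ring

theorem collinear_of_area_eq_zero {p q r : ℂ} (h : area p q r = 0) :
    Collinear ℝ {p, q, r} := by
  by_cases hpq : p = q
  · subst hpq
    simpa using collinear_pair ℝ p r
  rw [collinear_iff_of_mem (p₀ := p) (by simp)]
  refine ⟨q - p, ?_⟩
  have hN : (q.re - p.re) ^ 2 + (q.im - p.im) ^ 2 ≠ 0 := by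
    intro h0
    apply hpq
    apply Complex.ext <;> nlinarith [sq_nonneg (q.re - p.re), sq_nonneg (q.im - p.im)]
  obtain ⟨t, ht⟩ : ∃ t : ℝ, t * ((q.re - p.re) ^ 2 + (q.im - p.im) ^ 2) =
      (q.re - p.re) * (r.re - p.re) + (q.im - p.im) * (r.im - p.im) :=
    ⟨_, div_mul_cancel₀ _ hN⟩
  simp only [Set.mem_insert_iff, Set.mem_singleton_iff, forall_eq_or_imp, forall_eq]
  refine ⟨⟨0, by simp⟩, ⟨1, by simp⟩, ⟨t, ?_⟩⟩
  unfold area at h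
  apply Complex.ext
  · simp
    apply mul_left_cancel₀ hN
    linear_combination (-(q.im - p.im)) * h - (q.re - p.re) * ht
  · simp
    apply mul_left_cancel₀ hN
    linear_combination (q.re - p.re) * h - (q.im - p.im) * ht

theorem GeneralPosition.area_ne_zero {S : Finset ℂ} (hS : GeneralPosition S) {a b c : ℂ}
    (ha : a ∈ S) (hb : b ∈ S) (hc : c ∈ S) (hab : a ≠ b) (hac : a ≠ c) (hbc : b ≠ c) :
    area a b c ≠ 0 := by
  intro h
  refine hS.1 {a, b, c} (by simp [Finset.insert_subset_iff, *]) (by simp [*]) ?_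
  simpa using collinear_of_area_eq_zero h

/-- Open segments `ab` and `cd` have a common point. -/
def Cross (a b c d : ℂ) : Prop := (openSegment ℝ a b ∩ openSegment ℝ c d).Nonempty

/-- Signed area is affine in each vertex, so a common point makes a positive combination of the
areas of `a` and `b` over `cd` vanish, and likewise for `c` and `d` over `ab`. Conversely, opposite
signs determine both parameters. -/
theorem cross_iff {a b c d : ℂ} (ha : area b c d ≠ 0) (hb : area a c d ≠ 0) (hd : area a b c ≠ 0) :
    Cross a b c d ↔ area b c d * area a c d < 0 ∧ area a b d * area a b c < 0 := by
  constructor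
  · rintro ⟨x, ⟨s, s', hs, hs', hss, rfl⟩, ⟨t, t', ht, ht', htt, h⟩⟩
    obtain rfl : s' = 1 - s := by linarith
    obtain rfl : t' = 1 - t := by linarith
    have hre := congrArg Complex.re h
    have him := congrArg Complex.im h
    simp at hre him
    have e1 : s * area a c d + (1 - s) * area b c d = 0 := by
      unfold area
      linear_combination (d.im - c.im) * hre - (d.re - c.re) * him
    have e2 : t * area a b c + (1 - t) * area a b d = 0 := by
      unfold area
      linear_combination (-(b.im - a.im)) * hre + (b.re - a.re) * him
    constructor
    · have : (1 - s) * (area b c d * area a c d) = - s * area a c d ^ 2 := by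
        linear_combination area a c d * e1
      have := mul_pos hs (sq_pos_of_ne_zero hb)
      by_contra! hh
      have := mul_nonneg hs'.le hh
      linarith
    · have : (1 - t) * (area a b d * area a b c) = - t * area a b c ^ 2 := by
        linear_combination area a b c * e2
      have := mul_pos ht (sq_pos_of_ne_zero hd)
      by_contra! hh
      have := mul_nonneg ht'.le hh
      linarith
  · rintro ⟨h1, h2⟩
    have key : ∀ u v : ℝ, u * v < 0 → ∃ s : ℝ, 0 < s ∧ 0 < 1 - s ∧ s * (u - v) = u := by
      intro u v h
      rcases mul_neg_iff.1 h with ⟨hu, hv⟩ | ⟨hu, hv⟩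
      · have : 0 < u - v := by linarith
        refine ⟨u / (u - v), div_pos hu this, ?_, div_mul_cancel₀ _ this.ne'⟩
        rw [one_sub_div this.ne']
        exact div_pos (by linarith) this
      · have : u - v < 0 := by linarith
        refine ⟨u / (u - v), div_pos_of_neg_of_neg hu this, ?_, div_mul_cancel₀ _ this.ne⟩
        rw [one_sub_div this.ne]
        exact div_pos_of_neg_of_neg (by linarith) this
    obtain ⟨s, hs, hs', es⟩ := key _ _ h1
    obtain ⟨t, ht, ht', et⟩ := key _ _ h2
    have e : area b c d - area a c d ≠ 0 := by
      intro h0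
      rw [h0, mul_zero] at es
      exact ha es.symm
    refine ⟨s • a + (1 - s) • b, ⟨_, _, hs, hs', by ring, rfl⟩, ⟨t, 1 - t, ht, ht', by ring, ?_⟩⟩
    have et' : t * (area b c d - area a c d) = -area a b d := by
      rw [← et]
      unfold area
      ring
    apply Complex.ext
    · simp
      apply mul_left_cancel₀ e
      have : area b c d * (a.re - b.re) + area a b d * (c.re - d.re) =
          (d.re - b.re) * (area b c d - area a c d) := by unfold area; ring
      linear_combination (c.re - d.re) * et' - (a.re - b.re) * es - this
    · simp
      apply mul_left_cancel₀ e
      have : area b c d * (a.im - b.im) + area a b d * (c.im - d.im) =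
          (d.im - b.im) * (area b c d - area a c d) := by unfold area; ring
      linear_combination (c.im - d.im) * et' - (a.im - b.im) * es - this

theorem not_cross_of_area_ne_zero {a b c : ℂ} (h : area a b c ≠ 0) : ¬ Cross a b a c := by
  rintro ⟨x, ⟨s, s', hs, hs', hss, rfl⟩, ⟨t, t', ht, ht', htt, hx⟩⟩
  obtain rfl : s = 1 - s' := by linarith
  obtain rfl : t = 1 - t' := by linarith
  have hre := congrArg Complex.re hx
  have him := congrArg Complex.im hx
  simp at hre him
  have : t' * area a b c = 0 := by
    unfold area
    linear_combination (-(b.im - a.im)) * hre + (b.re - a.re) * him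
  rcases mul_eq_zero.1 this with h' | h' <;> [linarith; exact h h']

/-! ### Circumcircles and the in-circle determinant. -/

theorem dist_sq (p c : ℂ) : dist p c ^ 2 = (p.re - c.re) ^ 2 + (p.im - c.im) ^ 2 := by
  rw [Complex.dist_eq_re_im, Real.sq_sqrt (by positivity)]

/-- The affine dependency of four points, evaluated at the squared distances from the origin. -/
def inDet (a b c d : ℂ) : ℝ :=
  area b c d * (a.re ^ 2 + a.im ^ 2) - area a c d * (b.re ^ 2 + b.im ^ 2) +
    area a b d * (c.re ^ 2 + c.im ^ 2) - area a b c * (d.re ^ 2 + d.im ^ 2)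

/-- The alternating areas form an affine dependency of the four points, so it kills affine
functions, and the squared distances to `x` and to the origin differ by one. Hence the origin may be
moved to the circumcenter, where only the power of `d` remains. -/
theorem area_mul_power {a b c d x : ℂ} {r : ℝ} (ha : dist a x = r) (hb : dist b x = r)
    (hc : dist c x = r) : -area a b c * (dist d x ^ 2 - r ^ 2) = inDet a b c d := by
  have ha' := dist_sq a x
  have hb' := dist_sq b x
  have hc' := dist_sq c x
  have hd' := dist_sq d x
  rw [ha] at ha'
  rw [hb] at hb'
  rw [hc] at hc'
  rw [hd']
  unfold inDet
  have e : area b c d = area a b c + area a c d - area a b d := by unfold area; ring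
  have h1 : area b c d * ((a.re - x.re) ^ 2 + (a.im - x.im) ^ 2) -
    area a c d * ((b.re - x.re) ^ 2 + (b.im - x.im) ^ 2) +
    area a b d * ((c.re - x.re) ^ 2 + (c.im - x.im) ^ 2) -
    area a b c * ((d.re - x.re) ^ 2 + (d.im - x.im) ^ 2) =
      area b c d * (a.re ^ 2 + a.im ^ 2) - area a c d * (b.re ^ 2 + b.im ^ 2) +
    area a b d * (c.re ^ 2 + c.im ^ 2) - area a b c * (d.re ^ 2 + d.im ^ 2) := by
    unfold area; ring
  rw [← h1, ← ha', ← hb', ← hc', e]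
  ring

theorem dist_lt_iff_inDet {a b c d x : ℂ} {r : ℝ} (h0 : area a b c ≠ 0) (ha : dist a x = r)
    (hb : dist b x = r) (hc : dist c x = r) :
    dist d x < r ↔ 0 < area a b c * inDet a b c d := by
  have h := area_mul_power (d := d) ha hb hc
  have hr : 0 ≤ r := ha ▸ dist_nonneg
  have h2 : area a b c * inDet a b c d = area a b c ^ 2 * (r ^ 2 - dist d x ^ 2) := by
    rw [← h]; ring
  rw [h2, mul_pos_iff_of_pos_left (sq_pos_of_ne_zero h0), sub_pos,
    sq_lt_sq₀ dist_nonneg hr]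

theorem dist_eq_of_inDet_eq_zero {a b c d x : ℂ} {r : ℝ} (h0 : area a b c ≠ 0) (ha : dist a x = r)
    (hb : dist b x = r) (hc : dist c x = r) (h : inDet a b c d = 0) : dist d x = r := by
  rw [← area_mul_power (d := d) ha hb hc] at h
  have hr : 0 ≤ r := ha ▸ dist_nonneg
  have := (mul_eq_zero.1 h).resolve_left (neg_ne_zero.2 h0)
  rw [sub_eq_zero] at this
  exact (sq_eq_sq₀ dist_nonneg hr).1 this

theorem exists_circumcenter {a b c : ℂ} (h0 : area a b c ≠ 0) :
    ∃ x : ℂ, dist b x = dist a x ∧ dist c x = dist a x := by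
  -- `u` and `v` are the coordinates of the circumcenter relative to `a`, by Cramer's rule for the
  -- two perpendicular bisectors.
  obtain ⟨u, hu⟩ : ∃ u : ℝ, u * (2 * area a b c) = (c.im - a.im) * ((b.re - a.re) ^ 2 +
      (b.im - a.im) ^ 2) - (b.im - a.im) * ((c.re - a.re) ^ 2 + (c.im - a.im) ^ 2) :=
    ⟨_, div_mul_cancel₀ _ (by simpa using h0)⟩
  obtain ⟨v, hv⟩ : ∃ v : ℝ, v * (2 * area a b c) = (b.re - a.re) * ((c.re - a.re) ^ 2 +
      (c.im - a.im) ^ 2) - (c.re - a.re) * ((b.re - a.re) ^ 2 + (b.im - a.im) ^ 2) :=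
    ⟨_, div_mul_cancel₀ _ (by simpa using h0)⟩
  refine ⟨⟨a.re + u, a.im + v⟩, ?_, ?_⟩
  all_goals
    rw [← sq_eq_sq₀ dist_nonneg dist_nonneg, dist_sq, dist_sq]
    apply mul_left_cancel₀ h0
  · unfold area at *
    linear_combination (-(b.re - a.re)) * hu - (b.im - a.im) * hv
  · unfold area at *
    linear_combination (-(c.re - a.re)) * hu - (c.im - a.im) * hv

theorem circumcenter_unique {a b c x y : ℂ} (h0 : area a b c ≠ 0) (hb : dist b x = dist a x)
    (hc : dist c x = dist a x) (hb' : dist b y = dist a y) (hc' : dist c y = dist a y) :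
    x = y := by
  rw [← sq_eq_sq₀ dist_nonneg dist_nonneg, dist_sq, dist_sq] at hb hc hb' hc'
  apply Complex.ext <;> apply mul_left_cancel₀ h0 <;> unfold area
  · linear_combination ((c.im - a.im) * (hb' - hb) - (b.im - a.im) * (hc' - hc)) / 2
  · linear_combination ((b.re - a.re) * (hc' - hc) - (c.re - a.re) * (hb' - hb)) / 2

/-! ### Sign patterns of four points. -/

theorem area_add_area (a b c d : ℂ) : area b c d + area a b d = area a c d + area a b c := by
  unfold area; ring

theorem inDet_swap₃ (a b c d : ℂ) : inDet a b d c = -inDet a b c d := by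
  unfold inDet area; ring

-- Here and below `A`, `B`, `C`, `D` are the areas of the triples omitting `a`, `b`, `c`, `d`. The
-- relation `h` excludes `A, C` of one sign with `B, D` of the other; among the remaining patterns,
-- a positive product means convex position.
open Classical in
theorem sign_count_cross {A B C D : ℝ} (hA : A ≠ 0) (hB : B ≠ 0) (hC : C ≠ 0) (hD : D ≠ 0)
    (h : A + C = B + D) :
    (if A * B < 0 ∧ C * D < 0 then 1 else 0) + (if 0 < A * C ∧ 0 < B * D then 1 else 0) +
      (if A * D < 0 ∧ B * C < 0 then 1 else 0) = if 0 < A * B * C * D then 1 else 0 := by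
  rcases hA.lt_or_gt with hA | hA <;> rcases hB.lt_or_gt with hB | hB <;>
  rcases hC.lt_or_gt with hC | hC <;> rcases hD.lt_or_gt with hD | hD <;>
  first
  | (exfalso; linarith)
  | simp [mul_pos_iff, mul_neg_iff, hA, hB, hC, hD, hA.not_gt, hB.not_gt, hC.not_gt, hD.not_gt]

open Classical in
theorem sign_count_side {A B C D : ℝ} (hA : A ≠ 0) (hB : B ≠ 0) (hC : C ≠ 0) (hD : D ≠ 0)
    (h : A + C = B + D) :
    (if 0 < A * B then 1 else 0) + (if A * C < 0 then 1 else 0) + (if 0 < A * D then 1 else 0) +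
      (if 0 < B * C then 1 else 0) + (if B * D < 0 then 1 else 0) + (if 0 < C * D then 1 else 0) =
      3 + if 0 < A * B * C * D then 1 else 0 := by
  rcases hA.lt_or_gt with hA | hA <;> rcases hB.lt_or_gt with hB | hB <;>
  rcases hC.lt_or_gt with hC | hC <;> rcases hD.lt_or_gt with hD | hD <;>
  first
  | (exfalso; linarith)
  | simp [mul_pos_iff, mul_neg_iff, hA, hB, hC, hD, hA.not_gt, hB.not_gt, hC.not_gt, hD.not_gt]

-- `I` is the in-circle determinant and `x, y, z, w, u, v` are the squared distances `ab, ac, ad,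
-- bc, bd, cd`. The equations `h1` to `h4` are `I` computed with the origin moved to `a`, `b`, `c`,
-- `d` in turn.
open Classical in
theorem sign_count_inside {A B C D I x y z w u v : ℝ} (hA : A ≠ 0) (hB : B ≠ 0) (hC : C ≠ 0)
    (hD : D ≠ 0) (hI : I ≠ 0) (h : A + C = B + D) (hx : 0 < x) (hy : 0 < y) (hz : 0 < z)
    (hw : 0 < w) (hu : 0 < u) (hv : 0 < v) (h1 : I = -(B * x) + C * y - D * z)
    (h2 : I = A * x + C * w - D * u) (h3 : I = A * y - B * w - D * v)
    (h4 : I = A * z - B * u + C * v) :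
    (if A * I < 0 then 1 else 0) + (if 0 < B * I then 1 else 0) + (if C * I < 0 then 1 else 0) +
      (if 0 < D * I then 1 else 0) = 1 + if 0 < A * B * C * D then 1 else 0 := by
  have pp : ∀ s t : ℝ, 0 < s → 0 < t → 0 < s * t := fun _ _ => mul_pos
  have np : ∀ s t : ℝ, s < 0 → 0 < t → s * t < 0 := fun _ _ => mul_neg_of_neg_of_pos
  rcases hA.lt_or_gt with hA | hA <;> rcases hB.lt_or_gt with hB | hB <;>
  rcases hC.lt_or_gt with hC | hC <;> rcases hD.lt_or_gt with hD | hD <;>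
  rcases hI.lt_or_gt with hI | hI <;>
  first
  | (exfalso; linarith)
  | (simp [mul_pos_iff, mul_neg_iff, hA, hB, hC, hD, hI, hA.not_gt, hB.not_gt, hC.not_gt,
      hD.not_gt, hI.not_gt]; done)
  -- The sign of `I` is now wrong for the pattern: in one of `h1` to `h4` every term has the sign
  -- opposite to that of `I`.
  | (exfalso
     first
     | (have := np _ _ hA hx; have := np _ _ hC hw; have := pp _ _ hD hu; linarith)
     | (have := pp _ _ hA hx; have := pp _ _ hC hw; have := np _ _ hD hu; linarith)
     | (have := pp _ _ hB hx; have := np _ _ hC hy; have := pp _ _ hD hz; linarith)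
     | (have := np _ _ hB hx; have := pp _ _ hC hy; have := np _ _ hD hz; linarith)
     | (have := np _ _ hA hy; have := pp _ _ hB hw; have := pp _ _ hD hv; linarith)
     | (have := pp _ _ hA hy; have := np _ _ hB hw; have := np _ _ hD hv; linarith)
     | (have := np _ _ hA hz; have := pp _ _ hB hu; have := np _ _ hC hv; linarith)
     | (have := pp _ _ hA hz; have := np _ _ hB hu; have := pp _ _ hC hv; linarith))

/-! ### Sums over ordered quadruples. -/

/-- Ordered quadruples of distinct points of `S`, as pairs of pairs. -/
noncomputable def quadruples (S : Finset ℂ) : Finset ((ℂ × ℂ) × ℂ × ℂ) :=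
  ((S ×ˢ S) ×ˢ S ×ˢ S).filter fun t => t.1.1 ≠ t.1.2 ∧ t.1.1 ≠ t.2.1 ∧ t.1.1 ≠ t.2.2 ∧
    t.1.2 ≠ t.2.1 ∧ t.1.2 ≠ t.2.2 ∧ t.2.1 ≠ t.2.2

theorem mem_quadruples {S : Finset ℂ} {a b c d : ℂ} : ((a, b), c, d) ∈ quadruples S ↔
    (a ∈ S ∧ b ∈ S ∧ c ∈ S ∧ d ∈ S) ∧ a ≠ b ∧ a ≠ c ∧ a ≠ d ∧ b ≠ c ∧ b ≠ d ∧ c ≠ d := by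
  simp [quadruples, and_assoc]

/-- The sum of `f` over the ordered quadruples of distinct points of `S`. -/
noncomputable def quadSum (S : Finset ℂ) (f : ℂ → ℂ → ℂ → ℂ → ℕ) : ℕ :=
  ∑ t ∈ quadruples S, f t.1.1 t.1.2 t.2.1 t.2.2

theorem quadSum_swap₁ (S : Finset ℂ) (f : ℂ → ℂ → ℂ → ℂ → ℕ) :
    quadSum S (fun a b c d => f b a c d) = quadSum S f := by
  refine Finset.sum_nbij' (fun t => ((t.1.2, t.1.1), t.2)) (fun t => ((t.1.2, t.1.1), t.2))
    ?_ ?_ (fun _ _ => rfl) (fun _ _ => rfl) (fun _ _ => rfl)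
  all_goals
    rintro ⟨⟨a, b⟩, c, d⟩ h
    rw [mem_quadruples] at h ⊢
    grind

theorem quadSum_swap₂ (S : Finset ℂ) (f : ℂ → ℂ → ℂ → ℂ → ℕ) :
    quadSum S (fun a b c d => f a c b d) = quadSum S f := by
  refine Finset.sum_nbij' (fun t => ((t.1.1, t.2.1), t.1.2, t.2.2))
    (fun t => ((t.1.1, t.2.1), t.1.2, t.2.2))
    ?_ ?_ (fun _ _ => rfl) (fun _ _ => rfl) (fun _ _ => rfl)
  all_goals
    rintro ⟨⟨a, b⟩, c, d⟩ h
    rw [mem_quadruples] at h ⊢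
    grind

theorem quadSum_swap₃ (S : Finset ℂ) (f : ℂ → ℂ → ℂ → ℂ → ℕ) :
    quadSum S (fun a b c d => f a b d c) = quadSum S f := by
  refine Finset.sum_nbij' (fun t => (t.1, t.2.2, t.2.1)) (fun t => (t.1, t.2.2, t.2.1))
    ?_ ?_ (fun _ _ => rfl) (fun _ _ => rfl) (fun _ _ => rfl)
  all_goals
    rintro ⟨⟨a, b⟩, c, d⟩ h
    rw [mem_quadruples] at h ⊢
    grind

theorem quadSum_add (S : Finset ℂ) (f g : ℂ → ℂ → ℂ → ℂ → ℕ) :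
    quadSum S (fun a b c d => f a b c d + g a b c d) = quadSum S f + quadSum S g :=
  Finset.sum_add_distrib

theorem quadSum_congr {S : Finset ℂ} {f g : ℂ → ℂ → ℂ → ℂ → ℕ}
    (h : ∀ a b c d, ((a, b), c, d) ∈ quadruples S → f a b c d = g a b c d) :
    quadSum S f = quadSum S g :=
  Finset.sum_congr rfl fun ⟨⟨a, b⟩, c, d⟩ ht => h a b c d ht

theorem quadSum_const_mul (S : Finset ℂ) (k : ℕ) (f : ℂ → ℂ → ℂ → ℂ → ℕ) :
    quadSum S (fun a b c d => k * f a b c d) = k * quadSum S f :=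
  (Finset.mul_sum _ _ _).symm

theorem GeneralPosition.areas_ne_zero {S : Finset ℂ} (hS : GeneralPosition S) {a b c d : ℂ}
    (h : ((a, b), c, d) ∈ quadruples S) :
    area b c d ≠ 0 ∧ area a c d ≠ 0 ∧ area a b d ≠ 0 ∧ area a b c ≠ 0 := by
  obtain ⟨⟨ha, hb, hc, hd⟩, hab, hac, had, hbc, hbd, hcd⟩ := mem_quadruples.1 h
  exact ⟨hS.area_ne_zero hb hc hd hbc hbd hcd, hS.area_ne_zero ha hc hd hac had hcd,
    hS.area_ne_zero ha hb hd hab had hbd, hS.area_ne_zero ha hb hc hab hac hbc⟩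

theorem GeneralPosition.inDet_ne_zero {S : Finset ℂ} (hS : GeneralPosition S) {a b c d : ℂ}
    (h : ((a, b), c, d) ∈ quadruples S) : inDet a b c d ≠ 0 := by
  intro h0
  obtain ⟨-, -, -, hD⟩ := hS.areas_ne_zero h
  obtain ⟨⟨ha, hb, hc, hd⟩, hab, hac, had, hbc, hbd, hcd⟩ := mem_quadruples.1 h
  obtain ⟨x, hx, hx'⟩ := exists_circumcenter hD
  refine hS.2 {a, b, c, d} (by simp [Finset.insert_subset_iff, *]) (by simp [*])
    ⟨x, dist a x, ?_⟩
  simp [hx, hx', dist_eq_of_inDet_eq_zero hD rfl hx hx' h0]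

open Classical in
/-- The indicator of four points being in convex position. -/
noncomputable def convexInd (a b c d : ℂ) : ℕ :=
  if 0 < area b c d * area a c d * area a b d * area a b c then 1 else 0

open Classical in
/-- The indicator of the segments `ab` and `cd` crossing. -/
noncomputable def crossInd (a b c d : ℂ) : ℕ := if Cross a b c d then 1 else 0

open Classical in
/-- The indicator of `d` lying inside the circumcircle of `abc`. -/
noncomputable def insideInd (a b c d : ℂ) : ℕ :=
  if 0 < area a b c * inDet a b c d then 1 else 0

open Classical in
/-- The indicator of `c` and `d` lying on the same side of the line `ab`. -/
noncomputable def sideInd (a b c d : ℂ) : ℕ :=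
  if 0 < area a b c * area a b d then 1 else 0

/-! ### Crossings, sides and circles in terms of convex position. -/

/-- `quadSum` is invariant under permuting the four arguments, so the pointwise identity over the
three pairings sums to three equal terms. The next two results use the six lines and the four
circles in the same way. -/
theorem three_mul_quadSum_crossInd {S : Finset ℂ} (hS : GeneralPosition S) :
    3 * quadSum S crossInd = quadSum S convexInd := by
  have h1 : quadSum S (fun a b c d => crossInd a c b d) = quadSum S crossInd :=
    quadSum_swap₂ S crossInd
  have h2 : quadSum S (fun a b c d => crossInd a d b c) = quadSum S crossInd :=
    (quadSum_swap₃ S fun a b c d => crossInd a c b d).trans h1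
  have h3 : quadSum S (fun a b c d => crossInd a b c d + crossInd a c b d + crossInd a d b c) =
      quadSum S convexInd := by
    refine quadSum_congr fun a b c d h => ?_
    obtain ⟨hA, hB, hC, hD⟩ := hS.areas_ne_zero h
    rw [convexInd, ← sign_count_cross hA hB hC hD (area_add_area a b c d)]
    have e1 : area c b d = -area b c d := area_swap' _ _ _
    have e2 : area a c b = -area a b c := area_swap _ _ _
    have e3 : area d b c = area b c d := by unfold area; ring
    have e4 : area a d c = -area a c d := area_swap _ _ _
    have e5 : area a d b = -area a b d := area_swap _ _ _
    unfold crossInd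
    rw [cross_iff hA hB hD, cross_iff (a := a) (b := c) (c := b) (d := d) (by simpa [e1])
      hC (by simpa [e2]), cross_iff (a := a) (b := d) (c := b) (d := c) (by simpa [e3])
      hD (by simpa [e5]), e1, e2, e3, e4, e5]
    simp only [neg_mul, mul_neg, neg_lt_zero, neg_neg, mul_comm (area a b d) (area a b c)]
  rw [← h3, quadSum_add, quadSum_add, h1, h2]
  ring

theorem six_mul_quadSum_sideInd {S : Finset ℂ} (hS : GeneralPosition S) :
    6 * quadSum S sideInd = 3 * quadSum S (fun _ _ _ _ => 1) + quadSum S convexInd := by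
  have h1 : quadSum S (fun a b c d => sideInd a c b d) = quadSum S sideInd :=
    quadSum_swap₂ S sideInd
  have h2 : quadSum S (fun a b c d => sideInd a d b c) = quadSum S sideInd :=
    (quadSum_swap₃ S fun a b c d => sideInd a c b d).trans h1
  have h3 : quadSum S (fun a b c d => sideInd b c a d) = quadSum S sideInd :=
    (quadSum_swap₁ S fun a b c d => sideInd a c b d).trans h1
  have h4 : quadSum S (fun a b c d => sideInd b d a c) = quadSum S sideInd :=
    (quadSum_swap₁ S fun a b c d => sideInd a d b c).trans h2
  have h5 : quadSum S (fun a b c d => sideInd c d a b) = quadSum S sideInd :=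
    (quadSum_swap₂ S fun a b c d => sideInd b d a c).trans h4
  have h6 : quadSum S (fun a b c d => sideInd a b c d + sideInd a c b d + sideInd a d b c +
      sideInd b c a d + sideInd b d a c + sideInd c d a b) =
      quadSum S fun a b c d => 3 * 1 + convexInd a b c d := by
    refine quadSum_congr fun a b c d h => ?_
    obtain ⟨hA, hB, hC, hD⟩ := hS.areas_ne_zero h
    rw [convexInd, mul_one, ← sign_count_side hA hB hC hD (area_add_area a b c d)]
    have e2 : area a c b = -area a b c := area_swap _ _ _
    have e3 : area a d b = -area a b d := area_swap _ _ _
    have e4 : area a d c = -area a c d := area_swap _ _ _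
    have e5 : area b c a = area a b c := by unfold area; ring
    have e6 : area b d a = area a b d := by unfold area; ring
    have e7 : area b d c = -area b c d := area_swap _ _ _
    have e8 : area c d a = area a c d := by unfold area; ring
    have e9 : area c d b = area b c d := by unfold area; ring
    unfold sideInd
    rw [e2, e3, e4, e5, e6, e7, e8, e9]
    simp only [neg_mul, mul_neg, neg_neg, Left.neg_pos_iff]
    rw [mul_comm (area a b c) (area a b d), mul_comm (area a b c) (area a c d),
      mul_comm (area a b d) (area a c d), mul_comm (area a b c) (area b c d),
      mul_comm (area a b d) (area b c d), mul_comm (area a c d) (area b c d)]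
    ring
  rw [quadSum_add, quadSum_add, quadSum_add, quadSum_add, quadSum_add, h1, h2, h3, h4, h5,
    quadSum_add, quadSum_const_mul] at h6
  rw [← h6]
  ring

theorem four_mul_quadSum_insideInd {S : Finset ℂ} (hS : GeneralPosition S) :
    4 * quadSum S insideInd = quadSum S (fun _ _ _ _ => 1) + quadSum S convexInd := by
  have h1 : quadSum S (fun a b c d => insideInd a b d c) = quadSum S insideInd :=
    quadSum_swap₃ S insideInd
  have h2 : quadSum S (fun a b c d => insideInd a c d b) = quadSum S insideInd :=
    (quadSum_swap₂ S fun a b c d => insideInd a b d c).trans h1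
  have h3 : quadSum S (fun a b c d => insideInd b c d a) = quadSum S insideInd :=
    (quadSum_swap₁ S fun a b c d => insideInd a c d b).trans h2
  have h6 : quadSum S (fun a b c d => insideInd b c d a + insideInd a c d b +
      insideInd a b d c + insideInd a b c d) =
      quadSum S fun a b c d => 1 + convexInd a b c d := by
    refine quadSum_congr fun a b c d h => ?_
    obtain ⟨hA, hB, hC, hD⟩ := hS.areas_ne_zero h
    have hI := hS.inDet_ne_zero h
    obtain ⟨-, hab, hac, had, hbc, hbd, hcd⟩ := mem_quadruples.1 h
    have hpos : ∀ {p q : ℂ}, p ≠ q → 0 < (p.re - q.re) ^ 2 + (p.im - q.im) ^ 2 := by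
      intro p q hpq
      rw [← dist_sq]
      exact pow_pos (dist_pos.2 hpq) 2
    rw [convexInd, ← sign_count_inside (I := inDet a b c d) hA hB hC hD hI (area_add_area a b c d)
      (hpos hab) (hpos hac) (hpos had) (hpos hbc) (hpos hbd) (hpos hcd)
      (by unfold inDet area; ring) (by unfold inDet area; ring) (by unfold inDet area; ring)
      (by unfold inDet area; ring)]
    have e1 : inDet a b d c = -inDet a b c d := inDet_swap₃ _ _ _ _
    have e2 : inDet a c d b = inDet a b c d := by unfold inDet area; ring
    have e3 : inDet b c d a = -inDet a b c d := by unfold inDet area; ring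
    unfold insideInd
    rw [e1, e2, e3]
    simp only [mul_neg, Left.neg_pos_iff]
  rw [quadSum_add, quadSum_add, quadSum_add, h1, h2, h3, quadSum_add] at h6
  rw [← h6]
  ring

/-! ### Ordered triples and the number of quadruples. -/

/-- Ordered triples of distinct points of `S`. -/
noncomputable def triples (S : Finset ℂ) : Finset (ℂ × ℂ × ℂ) :=
  (S ×ˢ S ×ˢ S).filter fun t => t.1 ≠ t.2.1 ∧ t.1 ≠ t.2.2 ∧ t.2.1 ≠ t.2.2

theorem mem_triples {S : Finset ℂ} {a b c : ℂ} :
    (a, b, c) ∈ triples S ↔ (a ∈ S ∧ b ∈ S ∧ c ∈ S) ∧ a ≠ b ∧ a ≠ c ∧ b ≠ c := by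
  simp [triples, and_assoc]

theorem sum_triples (S : Finset ℂ) (g : Finset ℂ → ℕ) :
    ∑ t ∈ triples S, g {t.1, t.2.1, t.2.2} = 6 * ∑ T ∈ S.powersetCard 3, g T := by
  have hmaps : ∀ t ∈ triples S, ({t.1, t.2.1, t.2.2} : Finset ℂ) ∈ S.powersetCard 3 := by
    rintro ⟨a, b, c⟩ h
    obtain ⟨⟨ha, hb, hc⟩, hab, hac, hbc⟩ := mem_triples.1 h
    rw [Finset.mem_powersetCard]
    exact ⟨by simp [Finset.insert_subset_iff, *], by simp [*]⟩
  rw [← Finset.sum_fiberwise_of_maps_to hmaps, Finset.mul_sum]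
  refine Finset.sum_congr rfl fun T hT => ?_
  have h1 : ∀ t ∈ (triples S).filter fun t => ({t.1, t.2.1, t.2.2} : Finset ℂ) = T,
      g {t.1, t.2.1, t.2.2} = g T := fun t ht => by rw [(Finset.mem_filter.1 ht).2]
  rw [Finset.sum_congr rfl h1, Finset.sum_const, smul_eq_mul]
  congr 1
  obtain ⟨hTS, hT3⟩ := Finset.mem_powersetCard.1 hT
  obtain ⟨x, y, z, hxy, hxz, hyz, rfl⟩ := Finset.card_eq_three.1 hT3
  have hx : x ∈ S := hTS (by simp)
  have hy : y ∈ S := hTS (by simp)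
  have hz : z ∈ S := hTS (by simp)
  have h2 : ((triples S).filter fun t => ({t.1, t.2.1, t.2.2} : Finset ℂ) = {x, y, z}) =
      {(x, y, z), (x, z, y), (y, x, z), (y, z, x), (z, x, y), (z, y, x)} := by
    ext ⟨a, b, c⟩
    simp only [Finset.mem_filter, mem_triples, Finset.mem_insert, Finset.mem_singleton,
      Prod.mk.injEq]
    constructor
    · rintro ⟨⟨-, hab, hac, hbc⟩, h⟩
      have ha : a ∈ ({x, y, z} : Finset ℂ) := h ▸ by simp
      have hb : b ∈ ({x, y, z} : Finset ℂ) := h ▸ by simp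
      have hc : c ∈ ({x, y, z} : Finset ℂ) := h ▸ by simp
      simp only [Finset.mem_insert, Finset.mem_singleton] at ha hb hc
      grind
    · rintro (⟨rfl, rfl, rfl⟩ | ⟨rfl, rfl, rfl⟩ | ⟨rfl, rfl, rfl⟩ | ⟨rfl, rfl, rfl⟩ |
        ⟨rfl, rfl, rfl⟩ | ⟨rfl, rfl, rfl⟩) <;>
      · refine ⟨⟨⟨by assumption, by assumption, by assumption⟩, by grind, by grind, by grind⟩, ?_⟩
        ext w
        simp only [Finset.mem_insert, Finset.mem_singleton] <;> tauto
  rw [h2]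
  simp [hxy, hxz, hyz, hxy.symm, hxz.symm, hyz.symm]

theorem quadSum_eq_sum_triples (S : Finset ℂ) (f : ℂ → ℂ → ℂ → ℂ → ℕ) :
    quadSum S f = ∑ t ∈ triples S, ∑ d ∈ S \ {t.1, t.2.1, t.2.2}, f t.1 t.2.1 t.2.2 d := by
  rw [Finset.sum_sigma']
  refine Finset.sum_nbij' (fun t => ⟨(t.1.1, t.1.2, t.2.1), t.2.2⟩)
    (fun t => ((t.1.1, t.1.2.1), t.1.2.2, t.2)) ?_ ?_ (fun _ _ => rfl) (fun _ _ => rfl)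
    (fun _ _ => rfl)
  · rintro ⟨⟨a, b⟩, c, d⟩ h
    rw [mem_quadruples] at h
    simp only [Finset.mem_sigma, mem_triples, Finset.mem_sdiff, Finset.mem_insert,
      Finset.mem_singleton]
    grind
  · rintro ⟨⟨a, b, c⟩, d⟩ h
    rw [mem_quadruples]
    simp only [Finset.mem_sigma, mem_triples, Finset.mem_sdiff, Finset.mem_insert,
      Finset.mem_singleton] at h
    grind

theorem quadSum_one (S : Finset ℂ) :
    quadSum S (fun _ _ _ _ => 1) = S.card * (S.card - 1) * (S.card - 2) * (S.card - 3) := by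
  rw [quadSum_eq_sum_triples]
  rw [sum_triples S fun T => ∑ d ∈ S \ T, 1]
  have : ∀ T ∈ S.powersetCard 3, ∑ d ∈ S \ T, 1 = S.card - 3 := by
    intro T hT
    obtain ⟨hTS, hT3⟩ := Finset.mem_powersetCard.1 hT
    rw [← Finset.card_eq_sum_ones, Finset.card_sdiff_of_subset hTS, hT3]
  rw [Finset.sum_congr rfl this, Finset.sum_const, Finset.card_powersetCard, smul_eq_mul,
    ← mul_assoc]
  congr 1
  have := Nat.descFactorial_eq_factorial_mul_choose S.card 3
  rw [show Nat.factorial 3 = 6 from rfl] at this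
  rw [← this]
  simp only [Nat.descFactorial, Nat.sub_zero]
  ring

/-! ### The crossing number as a sum over quadruples. -/

theorem Cross.symm_left {a b c d : ℂ} (h : Cross a b c d) : Cross b a c d := by
  unfold Cross at *
  rwa [openSegment_symm]

theorem Cross.symm_right {a b c d : ℂ} (h : Cross a b c d) : Cross a b d c := by
  unfold Cross at *
  rwa [openSegment_symm ℝ d c]

theorem Cross.swap {a b c d : ℂ} (h : Cross a b c d) : Cross c d a b := by
  unfold Cross at *
  rwa [Set.inter_comm]

theorem finset_pair_eq_pair_iff {α : Type*} [DecidableEq α] {a b c d : α} :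
    ({a, b} : Finset α) = {c, d} ↔ a = c ∧ b = d ∨ a = d ∧ b = c := by
  rw [← Finset.coe_inj]
  push_cast
  exact Set.pair_eq_pair_iff

/-- Each crossing pair of edges comes from eight quadruples: two orders inside each edge and two
orders of the edges. Distinct edges with a common endpoint do not cross, so nothing is lost by
requiring four distinct points. -/
theorem eight_mul_crossingNumber {S : Finset ℂ} (hS : GeneralPosition S) :
    8 * crossingNumber S = quadSum S crossInd := by
  classical
  let F : (ℂ × ℂ) × ℂ × ℂ → Finset (Finset ℂ) := fun t => {{t.1.1, t.1.2}, {t.2.1, t.2.2}}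
  let X := (quadruples S).filter fun t => Cross t.1.1 t.1.2 t.2.1 t.2.2
  have hX : ∀ a b c d, ((a, b), c, d) ∈ X ↔
      ((a, b), c, d) ∈ quadruples S ∧ Cross a b c d := fun a b c d => Finset.mem_filter
  have h1 : {P : Finset (Finset ℂ) | P ∈ (S.powersetCard 2).powersetCard 2 ∧
    ∃ a b c d : ℂ, P = {{a, b}, {c, d}} ∧
      (openSegment ℝ a b ∩ openSegment ℝ c d).Nonempty} = ↑(X.image F) := by
    ext P
    rw [Finset.mem_coe, Finset.mem_image]
    constructor
    · rintro ⟨hP, a, b, c, d, rfl, hx⟩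
      change Cross a b c d at hx
      refine ⟨((a, b), c, d), (hX _ _ _ _).2 ⟨mem_quadruples.2 ?_, hx⟩, rfl⟩
      obtain ⟨hPS, hP2⟩ := Finset.mem_powersetCard.1 hP
      have hne : ({a, b} : Finset ℂ) ≠ {c, d} := by
        intro h
        rw [h] at hP2
        simp at hP2
      obtain ⟨hab, hab2⟩ := Finset.mem_powersetCard.1 (hPS (by simp : {a, b} ∈ _))
      obtain ⟨hcd, hcd2⟩ := Finset.mem_powersetCard.1 (hPS (by simp : {c, d} ∈ _))
      have hab' : a ≠ b := by rintro rfl; simp at hab2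
      have hcd' : c ≠ d := by rintro rfl; simp at hcd2
      have ha : a ∈ S := hab (by simp)
      have hb : b ∈ S := hab (by simp)
      have hc : c ∈ S := hcd (by simp)
      have hd : d ∈ S := hcd (by simp)
      rw [Ne, finset_pair_eq_pair_iff] at hne
      have key : ∀ p q r : ℂ, p ∈ S → q ∈ S → r ∈ S → p ≠ q → p ≠ r → q ≠ r →
          ¬ Cross p q p r := fun p q r hp hq hr hpq hpr hqr =>
        not_cross_of_area_ne_zero (hS.area_ne_zero hp hq hr hpq hpr hqr)
      refine ⟨⟨ha, hb, hc, hd⟩, hab', ?_, ?_, ?_, ?_, hcd'⟩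
      · rintro rfl
        exact key a b d ha hb hd hab' hcd' (by tauto) hx
      · rintro rfl
        exact key a b c ha hb hc hab' hcd'.symm (by tauto) hx.symm_right
      · rintro rfl
        exact key b a d hb ha hd hab'.symm hcd' (by tauto) hx.symm_left
      · rintro rfl
        exact key b a c hb ha hc hab'.symm hcd'.symm (by tauto) hx.symm_left.symm_right
    · rintro ⟨⟨⟨a, b⟩, c, d⟩, ht, rfl⟩
      obtain ⟨ht, hx⟩ := (hX _ _ _ _).1 ht
      obtain ⟨⟨ha, hb, hc, hd⟩, hab, hac, had, hbc, hbd, hcd⟩ := mem_quadruples.1 ht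
      refine ⟨?_, a, b, c, d, rfl, hx⟩
      have hne : ({a, b} : Finset ℂ) ≠ {c, d} := by
        rw [Ne, finset_pair_eq_pair_iff]
        tauto
      simp [F, Finset.mem_powersetCard, Finset.insert_subset_iff, *]
  have h2 : quadSum S crossInd = X.card := by
    rw [Finset.card_filter]
    rfl
  rw [crossingNumber, h1, Set.ncard_coe_finset, h2,
    Finset.card_eq_sum_card_image F X, mul_comm, ← smul_eq_mul, ← Finset.sum_const]
  refine Finset.sum_congr rfl fun P hP => ?_
  obtain ⟨⟨⟨a, b⟩, c, d⟩, ht, rfl⟩ := Finset.mem_image.1 hP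
  obtain ⟨ht, hx⟩ := (hX _ _ _ _).1 ht
  obtain ⟨⟨ha, hb, hc, hd⟩, hab, hac, had, hbc, hbd, hcd⟩ := mem_quadruples.1 ht
  have h3 : X.filter (fun t => F t = F ((a, b), c, d)) =
      {((a, b), c, d), ((b, a), c, d), ((a, b), d, c), ((b, a), d, c),
        ((c, d), a, b), ((d, c), a, b), ((c, d), b, a), ((d, c), b, a)} := by
    ext ⟨⟨a', b'⟩, c', d'⟩
    simp only [Finset.mem_filter, hX, F, finset_pair_eq_pair_iff, Finset.mem_insert,
      Finset.mem_singleton, Prod.mk.injEq, mem_quadruples]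
    constructor
    · rintro ⟨-, ⟨⟨rfl, rfl⟩ | ⟨rfl, rfl⟩, ⟨rfl, rfl⟩ | ⟨rfl, rfl⟩⟩ |
        ⟨⟨rfl, rfl⟩ | ⟨rfl, rfl⟩, ⟨rfl, rfl⟩ | ⟨rfl, rfl⟩⟩⟩ <;>
      simp only [true_and, true_or, or_true, and_self]
    · have x2 := hx.symm_left
      have x3 := hx.symm_right
      have x4 := x2.symm_right
      have x5 := hx.swap
      have x6 := x5.symm_left
      have x7 := x5.symm_right
      have x8 := x6.symm_right
      rintro (⟨⟨rfl, rfl⟩, rfl, rfl⟩ | ⟨⟨rfl, rfl⟩, rfl, rfl⟩ | ⟨⟨rfl, rfl⟩, rfl, rfl⟩ |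
        ⟨⟨rfl, rfl⟩, rfl, rfl⟩ | ⟨⟨rfl, rfl⟩, rfl, rfl⟩ | ⟨⟨rfl, rfl⟩, rfl, rfl⟩ |
        ⟨⟨rfl, rfl⟩, rfl, rfl⟩ | ⟨⟨rfl, rfl⟩, rfl, rfl⟩) <;>
      · refine ⟨⟨by simp only [ne_eq, ha, hb, hc, hd, hab, hac, had, hbc, hbd, hcd, hab.symm, hac.symm,
          had.symm, hbc.symm, hbd.symm, hcd.symm, not_false_eq_true, and_self], by assumption⟩, by simp⟩
  rw [h3]
  simp [hab, hac, had, hbc, hbd, hcd, hab.symm, hac.symm, had.symm, hbc.symm, hbd.symm,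
    hcd.symm]

/-! ### Counting by directed lines. -/

open Classical in
/-- The points of `S` to the right of the directed line `pq`. -/
noncomputable def rightSet (S : Finset ℂ) (e : ℂ × ℂ) : Finset ℂ :=
  S.filter fun r => RightOf e.1 e.2 r

theorem mem_rightSet {S : Finset ℂ} {a b r : ℂ} :
    r ∈ rightSet S (a, b) ↔ r ∈ S ∧ area a b r < 0 := by
  classical
  exact Finset.mem_filter

theorem numEdges_eq (S : Finset ℂ) (j : ℕ) :
    numEdges S j = (S.offDiag.filter fun e => (rightSet S e).card = j).card := by
  classical
  rw [numEdges, ← Set.ncard_coe_finset]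
  congr 1
  ext e
  have : {r : ℂ | r ∈ S ∧ RightOf e.1 e.2 r} = ↑(rightSet S e) := by
    ext r
    simp [rightSet]
  simp [this, and_assoc]

/-- A directed edge with `r` points on its right is counted in `E_{≤j}` for every `j ≥ r`. -/
theorem sum_numEdgesLE_mul (S : Finset ℂ) (m : ℕ) (w : ℕ → ℂ) :
    ∑ j ∈ Finset.Icc 0 m, (numEdgesLE S j : ℂ) * w j =
      ∑ e ∈ S.offDiag, ∑ j ∈ Finset.Icc (rightSet S e).card m, w j := by
  have h1 : ∀ j, (numEdgesLE S j : ℂ) =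
      ∑ e ∈ S.offDiag, if (rightSet S e).card ≤ j then 1 else 0 := by
    intro j
    rw [numEdgesLE, Finset.sum_boole]
    congr 1
    rw [Finset.card_eq_sum_card_fiberwise (f := fun e => (rightSet S e).card)
      (t := Finset.Icc 0 j)]
    · refine Finset.sum_congr rfl fun i hi => ?_
      rw [numEdges_eq, Finset.filter_filter]
      congr 1
      ext e
      have := Finset.mem_Icc.1 hi
      simp only [Finset.mem_filter]
      grind
    · intro e he
      simpa using (Finset.mem_filter.1 he).2
  simp_rw [h1, Finset.sum_mul]
  rw [Finset.sum_comm]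
  refine Finset.sum_congr rfl fun e _ => ?_
  simp_rw [ite_mul, one_mul, zero_mul]
  rw [← Finset.sum_filter]
  refine Finset.sum_congr ?_ fun _ _ => rfl
  ext j
  simp [and_comm]

theorem two_mul_sum_Icc {m i : ℕ} (hi : i ≤ m + 1) :
    2 * ∑ j ∈ Finset.Icc i m, (3 * (m : ℂ) / 4 - j) =
      (m + 1 - i) * (3 * m / 2) - (m * (m + 1) - i * (i - 1)) := by
  induction hi using Nat.decreasingInduction with
  | self =>
    simp
    ring
  | of_succ k hk ih =>
    rw [← Finset.add_sum_Ioc_eq_sum_Icc (by omega), mul_add]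
    have : Finset.Ioc k m = Finset.Icc (k + 1) m := by
      ext; simp
    rw [this, ih]
    push_cast
    ring

theorem rightSet_card_add {S : Finset ℂ} (hS : GeneralPosition S) {a b : ℂ}
    (h : (a, b) ∈ S.offDiag) :
    (rightSet S (a, b)).card + (rightSet S (b, a)).card = S.card - 2 := by
  obtain ⟨ha, hb, hab⟩ := Finset.mem_offDiag.1 h
  have hd : Disjoint (rightSet S (a, b)) (rightSet S (b, a)) := by
    rw [Finset.disjoint_left]
    intro r h1 h2
    have h3 : area b a r = -area a b r := area_swap' _ _ _
    have := (mem_rightSet.1 h1).2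
    have := (mem_rightSet.1 h2).2
    linarith
  rw [← Finset.card_union_of_disjoint hd]
  have : rightSet S (a, b) ∪ rightSet S (b, a) = S \ {a, b} := by
    ext r
    simp only [Finset.mem_union, mem_rightSet, Finset.mem_sdiff, Finset.mem_insert,
      Finset.mem_singleton, not_or]
    have h3 : area b a r = -area a b r := area_swap' _ _ _
    rw [h3]
    constructor
    · have h4 : area a b a = 0 := by unfold area; ring
      have h5 : area a b b = 0 := by unfold area; ring
      rintro (⟨hr, h⟩ | ⟨hr, h⟩) <;> refine ⟨hr, ?_, ?_⟩ <;> rintro rfl <;> simp [h4, h5] at h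
    · rintro ⟨hr, hra, hrb⟩
      have := hS.area_ne_zero ha hb hr hab (Ne.symm hra) (Ne.symm hrb)
      rcases this.lt_or_gt with h | h
      · exact Or.inl ⟨hr, h⟩
      · exact Or.inr ⟨hr, by linarith⟩
  rw [this, Finset.card_sdiff_of_subset (by simp [Finset.insert_subset_iff, *]),
    Finset.card_pair hab]

/-- Two points on one side of the line `ab` are either both right of `ab` or both right of `ba`. -/
theorem quadSum_sideInd (S : Finset ℂ) :
    quadSum S sideInd =
      ∑ e ∈ S.offDiag, ((rightSet S e).offDiag.card + (rightSet S e.swap).offDiag.card) := by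
  classical
  have h1 : quadSum S sideInd = ∑ t ∈ (quadruples S).filter
      (fun t => 0 < area t.1.1 t.1.2 t.2.1 * area t.1.1 t.1.2 t.2.2), 1 := by
    rw [Finset.sum_filter]
    rfl
  rw [h1, Finset.sum_finset_product _ S.offDiag
    (fun e => (rightSet S e).offDiag ∪ (rightSet S e.swap).offDiag)]
  · refine Finset.sum_congr rfl fun e _ => ?_
    rw [← Finset.card_eq_sum_ones, Finset.card_union_of_disjoint]
    rw [Finset.disjoint_left]
    rintro ⟨c, d⟩ h2 h3
    obtain ⟨a, b⟩ := e
    have h4 : area b a c = -area a b c := area_swap' _ _ _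
    have := (mem_rightSet.1 (Finset.mem_offDiag.1 h2).1).2
    have := (mem_rightSet.1 (Finset.mem_offDiag.1 h3).1).2
    linarith
  · rintro ⟨⟨a, b⟩, c, d⟩
    have h3 : area b a c = -area a b c := area_swap' _ _ _
    have h4 : area b a d = -area a b d := area_swap' _ _ _
    have ha : ∀ x, area x b x = 0 := fun x => by unfold area; ring
    have hb : ∀ x, area a x x = 0 := fun x => by unfold area; ring
    simp only [Finset.mem_filter, mem_quadruples, Finset.mem_union, Finset.mem_offDiag,
      mem_rightSet, Prod.swap, mul_pos_iff, h3, h4, Left.neg_neg_iff]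
    constructor
    · tauto
    · rintro ⟨⟨ha', hb', hab⟩, h⟩
      have hc : area a b c ≠ 0 := by
        intro h0
        simp [h0] at h
      have hd : area a b d ≠ 0 := by
        intro h0
        simp [h0] at h
      have : a ≠ c := by rintro rfl; exact hc (ha a)
      have : a ≠ d := by rintro rfl; exact hd (ha a)
      have : b ≠ c := by rintro rfl; exact hc (hb b)
      have : b ≠ d := by rintro rfl; exact hd (hb b)
      tauto

theorem offDiag_card_cast {α : Type*} [DecidableEq α] (s : Finset α) :
    (s.offDiag.card : ℂ) = s.card * (s.card - 1) := by
  rw [Finset.offDiag_card, Nat.cast_sub (Nat.le_mul_self _)]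
  push_cast
  ring

theorem quadSum_one_cast {S : Finset ℂ} (h3 : 3 ≤ S.card) :
    (quadSum S (fun _ _ _ _ => 1) : ℂ) =
      S.card * (S.card - 1) * (S.card - 2) * (S.card - 3) := by
  rw [quadSum_one]
  push_cast [Nat.cast_sub (by omega : 1 ≤ S.card), Nat.cast_sub (by omega : 2 ≤ S.card),
    Nat.cast_sub h3]
  ring

theorem crossingNumber_eq_sum_numEdgesLE {S : Finset ℂ} (hS : GeneralPosition S)
    (h3 : 3 ≤ S.card) :
    (crossingNumber S : ℂ) = ∑ j ∈ Finset.Icc 0 (S.card - 3),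
      (numEdgesLE S j : ℂ) * (3 * ((S.card : ℂ) - 3) / 4 - j) := by
  obtain ⟨m, hm⟩ := Nat.exists_eq_add_of_le h3
  have hm' : (S.card : ℂ) = 3 + m := by rw [hm]; push_cast; ring
  have hm'' : S.card - 3 = m := by omega
  rw [hm'', hm', add_sub_cancel_left, sum_numEdgesLE_mul]
  set W : ℂ × ℂ → ℂ := fun e => ∑ j ∈ Finset.Icc (rightSet S e).card m, (3 * (m : ℂ) / 4 - j)
  have hswap : ∑ e ∈ S.offDiag, W e.swap = ∑ e ∈ S.offDiag, W e := by
    refine Finset.sum_nbij' Prod.swap Prod.swap ?_ ?_ (fun _ _ => rfl) (fun _ _ => rfl)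
      (fun _ _ => rfl) <;>
    · intro e he
      simp only [Finset.mem_offDiag, Prod.fst_swap, Prod.snd_swap] at he ⊢
      exact ⟨he.2.1, he.1, he.2.2.symm⟩
  -- The two sides of an edge hold `m + 1` points together, so adding both orientations makes the
  -- linear terms of `two_mul_sum_Icc` constant and leaves `r(r-1) + l(l-1)`.
  have hW : ∀ e ∈ S.offDiag, 2 * (W e + W e.swap) =
      (((rightSet S e).offDiag.card + (rightSet S e.swap).offDiag.card : ℕ) : ℂ) -
        m * (m + 1) / 2 := by
    rintro ⟨a, b⟩ he
    have hc := rightSet_card_add hS he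
    have e1 := two_mul_sum_Icc (m := m) (i := (rightSet S (a, b)).card) (by omega)
    have e2 := two_mul_sum_Icc (m := m) (i := (rightSet S (b, a)).card) (by omega)
    have hc' : ((rightSet S (a, b)).card : ℂ) + (rightSet S (b, a)).card = m + 1 := by
      rw [← Nat.cast_add, hc, hm]
      push_cast [show 3 + m - 2 = m + 1 by omega]
      rfl
    rw [mul_add]
    push_cast
    rw [offDiag_card_cast, offDiag_card_cast]
    simp only [W, Prod.swap]
    rw [e1, e2]
    linear_combination (-(3 * (m : ℂ) / 2)) * hc'
  have h4 : 4 * ∑ e ∈ S.offDiag, W e =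
      (quadSum S sideInd : ℂ) - S.offDiag.card * (m * (m + 1) / 2) := by
    rw [quadSum_sideInd, Nat.cast_sum, ← nsmul_eq_mul, ← Finset.sum_const,
      ← Finset.sum_sub_distrib, ← Finset.sum_congr rfl hW, ← Finset.mul_sum,
      Finset.sum_add_distrib, hswap]
    ring
  have c1 := congrArg (Nat.cast (R := ℂ)) (eight_mul_crossingNumber hS)
  have c2 := congrArg (Nat.cast (R := ℂ)) (three_mul_quadSum_crossInd hS)
  have c3 := congrArg (Nat.cast (R := ℂ)) (six_mul_quadSum_sideInd hS)
  have c4 := quadSum_one_cast h3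
  push_cast at c1 c2 c3
  rw [offDiag_card_cast] at h4
  rw [c4] at c3
  rw [hm'] at h4 c3
  linear_combination (1 / 8) * c1 + (1 / 24) * c2 - (1 / 24) * c3 - (1 / 4) * h4

/-! ### Counting by circles through three points. -/

open EuclideanGeometry (Sphere)

theorem GeneralPosition.card_onSphere_le {S : Finset ℂ} (hS : GeneralPosition S) {U : Finset ℂ}
    (hU : U ⊆ S) {x : ℂ} {r : ℝ} (h : ∀ p ∈ U, dist p x = r) : U.card ≤ 3 := by
  by_contra! h4
  obtain ⟨T, hTU, hT4⟩ := Finset.exists_subset_card_eq (Nat.succ_le_of_lt h4)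
  exact hS.2 T (hTU.trans hU) hT4 ⟨x, r, fun p hp => h p (hTU hp)⟩

theorem GeneralPosition.existsUnique_sphere {S : Finset ℂ} (hS : GeneralPosition S)
    {T : Finset ℂ} (hT : T ∈ S.powersetCard 3) : ∃! C : Sphere ℂ, ∀ p ∈ T, p ∈ C := by
  obtain ⟨hTS, hT3⟩ := Finset.mem_powersetCard.1 hT
  obtain ⟨a, b, c, hab, hac, hbc, rfl⟩ := Finset.card_eq_three.1 hT3
  have h0 : area a b c ≠ 0 :=
    hS.area_ne_zero (hTS (by simp)) (hTS (by simp)) (hTS (by simp)) hab hac hbc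
  obtain ⟨x, hb, hc⟩ := exists_circumcenter h0
  have key : ∀ C : Sphere ℂ, (∀ p ∈ ({a, b, c} : Finset ℂ), p ∈ C) ↔
      dist a C.center = C.radius ∧ dist b C.center = C.radius ∧ dist c C.center = C.radius := by
    intro C
    simp only [Finset.mem_insert, Finset.mem_singleton, forall_eq_or_imp, forall_eq,
      EuclideanGeometry.mem_sphere]
  refine ⟨⟨x, dist a x⟩, (key _).2 ⟨rfl, hb, hc⟩, fun C hC => ?_⟩
  obtain ⟨ha', hb', hc'⟩ := (key C).1 hC
  have hx : C.center = x :=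
    circumcenter_unique h0 (hb'.trans ha'.symm) (hc'.trans ha'.symm) hb hc
  apply Sphere.ext hx
  rw [← ha', hx]

/-- A circle through the points of `T`. -/
noncomputable def circleThrough (T : Finset ℂ) : Sphere ℂ :=
  Classical.epsilon fun C => ∀ p ∈ T, p ∈ C

theorem GeneralPosition.mem_circleThrough {S : Finset ℂ} (hS : GeneralPosition S)
    {T : Finset ℂ} (hT : T ∈ S.powersetCard 3) : ∀ p ∈ T, p ∈ circleThrough T :=
  Classical.epsilon_spec (hS.existsUnique_sphere hT).exists

open Classical in
/-- The circles through three points of `S`. -/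
noncomputable def circles (S : Finset ℂ) : Finset (Sphere ℂ) :=
  (S.powersetCard 3).image circleThrough

open Classical in
/-- The points of `S` strictly inside `C`. -/
noncomputable def insideSet (S : Finset ℂ) (C : Sphere ℂ) : Finset ℂ :=
  S.filter fun s => dist s C.center < C.radius

theorem mem_insideSet {S : Finset ℂ} {C : Sphere ℂ} {s : ℂ} :
    s ∈ insideSet S C ↔ s ∈ S ∧ dist s C.center < C.radius := by
  classical
  exact Finset.mem_filter

theorem GeneralPosition.mem_circles {S : Finset ℂ} (hS : GeneralPosition S) {C : Sphere ℂ} :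
    C ∈ circles S ↔ ∃ T ⊆ S, T.card = 3 ∧ ∀ p ∈ T, p ∈ C := by
  classical
  rw [circles, Finset.mem_image]
  constructor
  · rintro ⟨T, hT, rfl⟩
    obtain ⟨hTS, hT3⟩ := Finset.mem_powersetCard.1 hT
    exact ⟨T, hTS, hT3, hS.mem_circleThrough hT⟩
  · rintro ⟨T, hTS, hT3, h⟩
    have hT := Finset.mem_powersetCard.2 ⟨hTS, hT3⟩
    exact ⟨T, hT, (hS.existsUnique_sphere hT).unique (hS.mem_circleThrough hT) h⟩

/-- Two triples on one circle have a union on that circle, hence of size at most three, so they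
coincide. -/
theorem GeneralPosition.circleThrough_injOn {S : Finset ℂ} (hS : GeneralPosition S) :
    Set.InjOn circleThrough (S.powersetCard 3 : Set (Finset ℂ)) := by
  intro T hT T' hT' h
  obtain ⟨hTS, hT3⟩ := Finset.mem_powersetCard.1 hT
  obtain ⟨hTS', hT3'⟩ := Finset.mem_powersetCard.1 hT'
  have hU : (T ∪ T').card ≤ 3 := by
    refine hS.card_onSphere_le (x := (circleThrough T).center) (r := (circleThrough T).radius)
      (Finset.union_subset hTS hTS') fun p hp => ?_
    rcases Finset.mem_union.1 hp with hp | hp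
    · exact hS.mem_circleThrough hT p hp
    · rw [h]
      exact hS.mem_circleThrough hT' p hp
  have h1 := Finset.eq_of_subset_of_card_le (Finset.subset_union_left (s₁ := T) (s₂ := T'))
    (by omega)
  have h2 := Finset.eq_of_subset_of_card_le (Finset.subset_union_right (s₁ := T) (s₂ := T'))
    (by omega)
  exact h1.trans h2.symm

theorem GeneralPosition.card_insideSet_add_le {S : Finset ℂ} (hS : GeneralPosition S)
    {C : Sphere ℂ} (hC : C ∈ circles S) : (insideSet S C).card + 3 ≤ S.card := by
  obtain ⟨T, hTS, hT3, h⟩ := hS.mem_circles.1 hC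
  rw [← hT3, ← Finset.card_union_of_disjoint]
  · exact Finset.card_le_card (Finset.union_subset (Finset.filter_subset _ _) hTS)
  · rw [Finset.disjoint_left]
    intro p hp hpT
    exact (mem_insideSet.1 hp).2.ne (h p hpT)

theorem GeneralPosition.numCircles_eq {S : Finset ℂ} (hS : GeneralPosition S) (k : ℕ) :
    numCircles S k = ((circles S).filter fun C => (insideSet S C).card = k).card := by
  rw [numCircles, ← Set.ncard_coe_finset]
  congr 1
  ext C
  have : {s : ℂ | s ∈ S ∧ dist s C.center < C.radius} = ↑(insideSet S C) := by
    ext s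
    simp [mem_insideSet]
  simp [this, hS.mem_circles]

theorem GeneralPosition.sum_numCircles_mul {S : Finset ℂ} (hS : GeneralPosition S)
    (w : ℕ → ℂ) : ∑ j ∈ Finset.Icc 0 (S.card - 3), (numCircles S j : ℂ) * w j =
      ∑ C ∈ circles S, w (insideSet S C).card := by
  rw [← Finset.sum_fiberwise_of_maps_to (g := fun C => (insideSet S C).card)
    (t := Finset.Icc 0 (S.card - 3))]
  · refine Finset.sum_congr rfl fun j _ => ?_
    rw [hS.numCircles_eq, ← nsmul_eq_mul, ← Finset.sum_const]
    exact Finset.sum_congr rfl fun C hC => by rw [(Finset.mem_filter.1 hC).2]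
  · intro C hC
    have := hS.card_insideSet_add_le hC
    simp
    omega

theorem GeneralPosition.quadSum_insideInd {S : Finset ℂ} (hS : GeneralPosition S) :
    quadSum S insideInd = 6 * ∑ C ∈ circles S, (insideSet S C).card := by
  classical
  rw [circles, Finset.sum_image hS.circleThrough_injOn,
    ← sum_triples S fun T => (insideSet S (circleThrough T)).card, quadSum_eq_sum_triples]
  refine Finset.sum_congr rfl fun ⟨a, b, c⟩ ht => ?_
  obtain ⟨⟨ha, hb, hc⟩, hab, hac, hbc⟩ := mem_triples.1 ht
  have h0 := hS.area_ne_zero ha hb hc hab hac hbc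
  have hT : ({a, b, c} : Finset ℂ) ∈ S.powersetCard 3 := by
    rw [Finset.mem_powersetCard]
    exact ⟨by simp [Finset.insert_subset_iff, *], by simp [*]⟩
  have hC := hS.mem_circleThrough hT
  have h1 : insideSet S (circleThrough {a, b, c}) =
      (S \ {a, b, c}).filter fun d => 0 < area a b c * inDet a b c d := by
    ext d
    rw [mem_insideSet, Finset.mem_filter, Finset.mem_sdiff, dist_lt_iff_inDet h0
      (hC a (by simp)) (hC b (by simp)) (hC c (by simp))]
    refine ⟨fun ⟨hd, h⟩ => ⟨⟨hd, fun hdT => ?_⟩, h⟩, fun ⟨⟨hd, _⟩, h⟩ => ⟨hd, h⟩⟩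
    rw [← dist_lt_iff_inDet h0 (hC a (by simp)) (hC b (by simp)) (hC c (by simp))] at h
    exact h.ne (hC d hdT)
  simp only [h1, Finset.card_filter, insideInd]

theorem GeneralPosition.card_circles {S : Finset ℂ} (hS : GeneralPosition S)
    (h3 : 3 ≤ S.card) :
    6 * ((circles S).card : ℂ) = S.card * (S.card - 1) * (S.card - 2) := by
  classical
  rw [circles, Finset.card_image_of_injOn hS.circleThrough_injOn, Finset.card_powersetCard]
  have := Nat.descFactorial_eq_factorial_mul_choose S.card 3
  have h := congrArg (Nat.cast (R := ℂ)) this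
  simp only [Nat.descFactorial, Nat.sub_zero] at h
  push_cast [Nat.cast_sub (by omega : 1 ≤ S.card), Nat.cast_sub (by omega : 2 ≤ S.card)] at h
  rw [show Nat.factorial 3 = 6 from rfl] at h
  push_cast at h
  rw [← h]
  ring

theorem GeneralPosition.crossingNumber_eq_sum_circles {S : Finset ℂ} (hS : GeneralPosition S)
    (h3 : 3 ≤ S.card) : (crossingNumber S : ℂ) =
      ∑ C ∈ circles S, ((insideSet S C).card - ((S.card : ℂ) - 3) / 4) := by
  have c1 := congrArg (Nat.cast (R := ℂ)) (eight_mul_crossingNumber hS)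
  have c2 := congrArg (Nat.cast (R := ℂ)) (three_mul_quadSum_crossInd hS)
  have c3 := congrArg (Nat.cast (R := ℂ)) (four_mul_quadSum_insideInd hS)
  have c4 := quadSum_one_cast h3
  have c5 := congrArg (Nat.cast (R := ℂ)) hS.quadSum_insideInd
  have c6 := hS.card_circles h3
  push_cast at c1 c2 c3 c5
  rw [Finset.sum_sub_distrib, Finset.sum_const, nsmul_eq_mul]
  linear_combination (1 / 8) * c1 + (1 / 24) * c2 - (1 / 24) * c3 - (1 / 24) * c4 +
    (1 / 6) * c5 + (((S.card : ℂ) - 3) / 24) * c6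

/-! ### Vertices of higher-order Voronoi diagrams. -/

/-- The sets of `k` nearest points of `S` to `x`. -/
def nearestSets (S : Finset ℂ) (k : ℕ) (x : ℂ) : Set (Finset ℂ) :=
  {A | A ⊆ S ∧ A.card = k ∧ x ∈ voronoiCell S A}

theorem exists_mem_sdiff_of_card_eq {α : Type*} [DecidableEq α] {A B : Finset α}
    (h : A.card = B.card) {b : α} (hb : b ∈ B) (hbA : b ∉ A) : ∃ a ∈ A, a ∉ B := by
  by_contra! hAB
  exact hbA (Finset.eq_of_subset_of_card_le hAB h.ge ▸ hb)

/-- An exchange argument: all sets of `k` nearest points share the same largest distance `r`, so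
each contains the points of the open disc and lies in the closed one. They can differ only on the
circle. -/
theorem insideSet_subset_of_mem_nearestSets {S A B : Finset ℂ} {k : ℕ} {x : ℂ} {r : ℝ}
    (hA : A ∈ nearestSets S k x) (hB : B ∈ nearestSets S k x) (hAr : ∀ a ∈ A, dist x a ≤ r)
    (hAr' : ∃ a ∈ A, dist x a = r) :
    (∀ s ∈ S, dist x s < r → s ∈ B) ∧ ∀ b ∈ B, dist x b ≤ r := by
  obtain ⟨hAS, hAk, hAx⟩ := hA
  obtain ⟨hBS, hBk, hBx⟩ := hB
  obtain ⟨a₀, ha₀, hr⟩ := hAr'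
  have hin : ∀ s ∈ S, dist x s < r → s ∈ A := by
    intro s hs hlt
    by_contra hsA
    have := hAx a₀ ha₀ s hs hsA
    linarith
  constructor
  · intro s hs hlt
    by_contra hsB
    obtain ⟨b, hb, hbA⟩ := exists_mem_sdiff_of_card_eq (hBk.trans hAk.symm) (hin s hs hlt) hsB
    exact hbA (hin b (hBS hb) ((hBx b hb s hs hsB).trans_lt hlt))
  · intro b hb
    by_cases hbA : b ∈ A
    · exact hAr b hbA
    · obtain ⟨a, ha, haB⟩ := exists_mem_sdiff_of_card_eq (hAk.trans hBk.symm) hb hbA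
      exact (hBx b hb a (hAS ha) haB).trans (hAr a ha)

theorem GeneralPosition.mem_voronoiVertices {S : Finset ℂ} (hS : GeneralPosition S) {k : ℕ}
    {x : ℂ} : x ∈ voronoiVertices S k ↔ ∃ C ∈ circles S, C.center = x ∧
      ((insideSet S C).card + 1 = k ∨ (insideSet S C).card + 2 = k) := by
  classical
  have hfin : (nearestSets S k x).Finite :=
    (Finset.finite_toSet S.powerset).subset fun A hA => by simpa using hA.1
  change 3 ≤ (nearestSets S k x).ncard ↔ _
  constructor
  · intro h3
    obtain ⟨A, hA⟩ : (nearestSets S k x).Nonempty := by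
      rw [← Set.ncard_pos hfin]
      omega
    -- For `k = 0` the empty set is the only candidate, so three cells cannot meet.
    have hne : A.Nonempty := by
      rw [Finset.nonempty_iff_ne_empty]
      rintro rfl
      have hk : 0 = k := hA.2.1
      have : nearestSets S k x ⊆ {∅} := by
        rintro B ⟨-, hB, -⟩
        rw [← hk] at hB
        exact Finset.card_eq_zero.1 hB
      have := Set.ncard_le_ncard this
      rw [Set.ncard_singleton] at this
      omega
    obtain ⟨a₀, ha₀, hmax⟩ := A.exists_max_image (fun a => dist x a) hne
    set r := dist x a₀ with hr
    let C : Sphere ℂ := ⟨x, r⟩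
    let T := S.filter fun s => dist x s = r
    have hall : ∀ B ∈ nearestSets S k x, insideSet S C ⊆ B ∧ B ⊆ insideSet S C ∪ T := by
      intro B hB
      obtain ⟨h1, h2⟩ := insideSet_subset_of_mem_nearestSets hA hB hmax ⟨a₀, ha₀, rfl⟩
      refine ⟨fun s hs => ?_, fun b hb => ?_⟩
      · have := mem_insideSet.1 hs
        exact h1 s this.1 (by rw [dist_comm]; exact this.2)
      · rw [Finset.mem_union, mem_insideSet, Finset.mem_filter]
        rcases (h2 b hb).lt_or_eq with h | h
        · exact Or.inl ⟨hB.1 hb, by rw [dist_comm]; exact h⟩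
        · exact Or.inr ⟨hB.1 hb, h⟩
    have hT3 : T.card ≤ 3 := hS.card_onSphere_le (Finset.filter_subset _ _) (x := x) (r := r)
      fun p hp => by rw [dist_comm]; exact (Finset.mem_filter.1 hp).2
    have hle : (nearestSets S k x).ncard ≤ (T.powersetCard (k - (insideSet S C).card)).card := by
      rw [← Set.ncard_coe_finset]
      refine Set.ncard_le_ncard_of_injOn (fun B => B \ insideSet S C) ?_ ?_ (Finset.finite_toSet _)
      · intro B hB
        obtain ⟨h1, h2⟩ := hall B hB
        rw [Finset.mem_coe, Finset.mem_powersetCard, Finset.card_sdiff_of_subset h1, hB.2.1]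
        exact ⟨sdiff_le_iff.2 h2, rfl⟩
      · intro B hB B' hB' h
        rw [← Finset.sdiff_union_of_subset (hall B hB).1,
          ← Finset.sdiff_union_of_subset (hall B' hB').1]
        exact congrArg (· ∪ insideSet S C) h
    rw [Finset.card_powersetCard] at hle
    -- At most three points lie on the circle, and among the binomials `t.choose s` with `t ≤ 3`
    -- only `t = 3` with `s = 1` or `s = 2` reaches three.
    have hkey : T.card = 3 ∧
        (k - (insideSet S C).card = 1 ∨ k - (insideSet S C).card = 2) := by
      generalize k - (insideSet S C).card = s at hle
      have hs : s ≤ 3 := by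
        by_contra! hs
        rw [Nat.choose_eq_zero_of_lt (by omega)] at hle
        omega
      generalize T.card = t at *
      interval_cases t <;> interval_cases s <;> simp [Nat.choose] at hle ⊢ <;> omega
    refine ⟨C, hS.mem_circles.2 ⟨T, Finset.filter_subset _ _, hkey.1, fun p hp => ?_⟩, rfl, ?_⟩
    · have := (Finset.mem_filter.1 hp).2
      rw [EuclideanGeometry.mem_sphere, dist_comm]
      exact this
    · omega
  · rintro ⟨C, hC, rfl, hk⟩
    obtain ⟨T, hTS, hT3, hT⟩ := hS.mem_circles.1 hC
    have hdisj : Disjoint T (insideSet S C) := by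
      rw [Finset.disjoint_left]
      intro p hpT hp
      exact (mem_insideSet.1 hp).2.ne (hT p hpT)
    have hcard : (T.powersetCard (k - (insideSet S C).card)).card = 3 := by
      rw [Finset.card_powersetCard, hT3]
      rcases hk with rfl | rfl <;> simp
    rw [← hcard, ← Set.ncard_coe_finset]
    -- Conversely, the interior points together with any one, respectively any two, of the three
    -- points on the circle form a nearest set, giving three cells.
    refine Set.ncard_le_ncard_of_injOn (fun U => U ∪ insideSet S C) ?_ ?_ hfin
    · intro U hU
      obtain ⟨hUT, hUc⟩ := Finset.mem_powersetCard.1 hU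
      refine ⟨Finset.union_subset (hUT.trans hTS) (Finset.filter_subset _ _), ?_, ?_⟩
      · rw [Finset.card_union_of_disjoint (hdisj.mono_left hUT), hUc]
        omega
      · intro a ha b hb hbA
        have h1 : dist C.center a ≤ C.radius := by
          rw [dist_comm]
          rcases Finset.mem_union.1 ha with h | h
          · exact (hT a (hUT h)).le
          · exact (mem_insideSet.1 h).2.le
        have h2 : C.radius ≤ dist C.center b := by
          rw [dist_comm]
          by_contra! h
          exact hbA (Finset.mem_union_right _ (mem_insideSet.2 ⟨hb, h⟩))
        exact h1.trans h2
    · intro U hU U' hU' h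
      have hd := hdisj.mono_left (Finset.mem_powersetCard.1 hU).1
      have hd' := hdisj.mono_left (Finset.mem_powersetCard.1 hU').1
      rw [← Finset.union_sdiff_cancel_right hd, ← Finset.union_sdiff_cancel_right hd']
      exact congrArg (· \ insideSet S C) h

/-- The larger disc also contains the three points on the smaller circle. The interior counts of two
circles giving a vertex of the same order differ by at most one, so such circles cannot be
concentric and distinct: a vertex determines its circle. -/
theorem GeneralPosition.card_insideSet_add_three_le {S : Finset ℂ} (hS : GeneralPosition S)
    {C C' : Sphere ℂ} (hC : C ∈ circles S) (hcen : C.center = C'.center)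
    (hr : C.radius < C'.radius) : (insideSet S C).card + 3 ≤ (insideSet S C').card := by
  obtain ⟨T, hTS, hT3, hT⟩ := hS.mem_circles.1 hC
  rw [← hT3, ← Finset.card_union_of_disjoint]
  · refine Finset.card_le_card (Finset.union_subset (fun p hp => ?_) fun p hp => ?_)
    · obtain ⟨h1, h2⟩ := mem_insideSet.1 hp
      exact mem_insideSet.2 ⟨h1, hcen ▸ h2.trans hr⟩
    · refine mem_insideSet.2 ⟨hTS hp, ?_⟩
      rw [← hcen]
      exact (EuclideanGeometry.mem_sphere.1 (hT p hp)).trans_lt hr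
  · rw [Finset.disjoint_left]
    intro p hp hpT
    exact (mem_insideSet.1 hp).2.ne (hT p hpT)

theorem GeneralPosition.numVoronoiVertices_eq {S : Finset ℂ} (hS : GeneralPosition S) (k : ℕ) :
    numVoronoiVertices S k = ((circles S).filter fun C =>
      (insideSet S C).card + 1 = k ∨ (insideSet S C).card + 2 = k).card := by
  classical
  have h1 : voronoiVertices S k = Sphere.center '' (((circles S).filter fun C =>
      (insideSet S C).card + 1 = k ∨ (insideSet S C).card + 2 = k : Finset _) : Set _) := by
    ext x
    rw [hS.mem_voronoiVertices]
    simp only [Set.mem_image, Finset.mem_coe, Finset.mem_filter]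
    exact ⟨fun ⟨C, h, h', h''⟩ => ⟨C, ⟨h, h''⟩, h'⟩, fun ⟨C, ⟨h, h''⟩, h'⟩ => ⟨C, h, h', h''⟩⟩
  rw [numVoronoiVertices, h1, Set.InjOn.ncard_image, Set.ncard_coe_finset]
  intro C hC C' hC' h
  obtain ⟨hC, hk⟩ := Finset.mem_filter.1 hC
  obtain ⟨hC', hk'⟩ := Finset.mem_filter.1 hC'
  refine Sphere.ext h ?_
  rcases lt_trichotomy C.radius C'.radius with hr | hr | hr
  · have := hS.card_insideSet_add_three_le hC h hr
    omega
  · exact hr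
  · have := hS.card_insideSet_add_three_le hC' h.symm hr
    omega

theorem GeneralPosition.sum_numVoronoiVertices_mul {S : Finset ℂ} (hS : GeneralPosition S)
    (w : ℕ → ℂ) : ∑ k ∈ Finset.Icc 1 (S.card - 1), (numVoronoiVertices S k : ℂ) * w k =
      ∑ C ∈ circles S, (w ((insideSet S C).card + 1) + w ((insideSet S C).card + 2)) := by
  simp_rw [hS.numVoronoiVertices_eq, ← Finset.sum_boole, Finset.sum_mul, ite_mul, one_mul,
    zero_mul]
  rw [Finset.sum_comm]
  refine Finset.sum_congr rfl fun C hC => ?_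
  have := hS.card_insideSet_add_le hC
  rw [← Finset.sum_filter]
  have h : (Finset.Icc 1 (S.card - 1)).filter (fun k => (insideSet S C).card + 1 = k ∨
      (insideSet S C).card + 2 = k) = {(insideSet S C).card + 1, (insideSet S C).card + 2} := by
    ext k
    simp only [Finset.mem_filter, Finset.mem_Icc, Finset.mem_insert, Finset.mem_singleton]
    omega
  rw [h, Finset.sum_pair (by omega)]

end PointSet

/-! ### Matching the linear weights with the root sums. -/

theorem mainTheorem6 (n : ℕ) (hn : 4 ≤ n) (S : Finset ℂ) (hcard : S.card = n)
    (hS : PointSet.GeneralPosition S) :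
    ((PointSet.crossingNumber S : ℂ) =
      ∑ j ∈ Finset.Icc 0 (n - 3), (PointSet.numCircles S j : ℂ) *
        (4 / (3 * ((n : ℂ) - 3)) *
          ∑ z ∈ Polynomial.nthRootsFinset (n - 3) (-3 : ℂ), z ^ (j + 1) / (z - 1) ^ 2)) ∧
    ((PointSet.crossingNumber S : ℂ) =
      ∑ j ∈ Finset.Icc 1 (n - 1), (PointSet.numVoronoiVertices S j : ℂ) *
        (2 / (3 * ((n : ℂ) - 1)) *
          ∑ z ∈ Polynomial.nthRootsFinset (n - 1) (-3 : ℂ), z ^ j / (z - 1) ^ 2)) ∧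
    ((PointSet.crossingNumber S : ℂ) =
      ∑ j ∈ Finset.Icc 0 (n - 3), (PointSet.numEdgesLE S j : ℂ) *
        (-4 / ((n : ℂ) - 3) *
          ∑ z ∈ Polynomial.nthRootsFinset (n - 3) (-(1 / 3) : ℂ), z ^ (j + 1) / (z - 1) ^ 2)) := by
  subst hcard
  have hm : ((S.card - 3 : ℕ) : ℂ) = S.card - 3 := by
    rw [Nat.cast_sub (by omega)]; rfl
  have hm1 : ((S.card - 1 : ℕ) : ℂ) = S.card - 1 := by
    rw [Nat.cast_sub (by omega)]; norm_num
  have h0 : (S.card : ℂ) - 3 ≠ 0 := by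
    rw [← hm, Nat.cast_ne_zero]; omega
  have h1 : (S.card : ℂ) - 1 ≠ 0 := by
    rw [← hm1, Nat.cast_ne_zero]; omega
  have ht : 3 ≤ S.card := by omega
  refine ⟨?_, ?_, ?_⟩
  · rw [hS.crossingNumber_eq_sum_circles ht,
      ← hS.sum_numCircles_mul fun j => (j : ℂ) - ((S.card : ℂ) - 3) / 4]
    refine Finset.sum_congr rfl fun j hj => ?_
    -- For `a = -3` and `m = n - 3` the root sum is `3m(4j - m)/16`.
    rw [sum_nthRootsFinset_pow_div (by omega) (by norm_num) (by norm_num)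
      (Finset.mem_Icc.1 hj).2, hm]
    field_simp
    ring
  -- The weight of a circle with `k` interior points is split over its two Voronoi orders `k + 1`
  -- and `k + 2`.
  · have h2 : ∀ C ∈ PointSet.circles S,
        ((PointSet.insideSet S C).card : ℂ) - ((S.card : ℂ) - 3) / 4 =
        (4 * ((((PointSet.insideSet S C).card + 1 : ℕ) : ℂ) - 1) - (S.card - 1)) / 8 +
        (4 * ((((PointSet.insideSet S C).card + 2 : ℕ) : ℂ) - 1) - (S.card - 1)) / 8 := by
      intro C _
      push_cast
      ring
    rw [hS.crossingNumber_eq_sum_circles ht, Finset.sum_congr rfl h2,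
      ← hS.sum_numVoronoiVertices_mul fun k => (4 * ((k : ℂ) - 1) - (S.card - 1)) / 8]
    refine Finset.sum_congr rfl fun j hj => ?_
    obtain ⟨hj1, hj2⟩ := Finset.mem_Icc.1 hj
    obtain ⟨i, rfl⟩ := Nat.exists_eq_add_of_le' hj1
    rw [sum_nthRootsFinset_pow_div (by omega) (by norm_num) (by norm_num) (by omega), hm1]
    push_cast
    field_simp
    ring
  · rw [PointSet.crossingNumber_eq_sum_numEdgesLE hS ht]
    refine Finset.sum_congr rfl fun j hj => ?_
    -- For `a = -1/3` and `m = n - 3` the root sum is `-(m/4)(3m/4 - j)`.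
    rw [sum_nthRootsFinset_pow_div (by omega) (by norm_num) (by norm_num)
      (Finset.mem_Icc.1 hj).2, hm]
    field_simp
    ring
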